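/- Let $n\ge 2$. A board is a finite set $B$ of squares $(i,j)$ (row $i$, column $j$), and $r_k(B)$ denotes the number of ways to place $k$ rooks on squares of $B$ with at most one rook in any row and at most one in any column. For a board $B$ with $m$ rows, the factorial polynomial of $B$ is $$R(t,B)=\sum_{k=0}^{m} r_k(B)\,(t)_{m-k},\qquad (t)_j=t(t-1)\cdots(t-j+1).$$ Let $L_{0,n}$ be the skew Ferrers board of shape $(2n-3,2n-4,\ldots,n-1)/(n-1,n-2,\ldots,1)$, which is regarded as having $n-1$ rows (for $n=2$ its single row is empty); explicitly, numbering rows from the bottom and columns from the left starting at $1$, $L_{0,n}=\{(i,j): 1\le i\le n-1,\ i+1\le j\le n-2+i\}$. Then, as polynomials in $t$ with rational coefficients, $$R(t,L_{0,n})=\frac{1}{2^n}\sum_{j=0}^{n}\binom{n}{j}(t-1+j)^{n-1}.$$ -/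

import Mathlib

open Polynomial

/-- A board: a finite set of squares `(i, j)`, where `i` is the row (counted from the bottom) and
`j` the column (counted from the left). Rows and columns of the boards below are numbered from 1. -/
abbrev Board : Type := Finset (ℕ × ℕ)

/-- A set of rooks is nonattacking if there is at most one rook in any row and in any column. -/
def IsNonattacking (P : Finset (ℕ × ℕ)) : Prop :=
  (∀ p ∈ P, ∀ q ∈ P, p.1 = q.1 → p = q) ∧ (∀ p ∈ P, ∀ q ∈ P, p.2 = q.2 → p = q)

instance (P : Finset (ℕ × ℕ)) : Decidable (IsNonattacking P) :=
  inferInstanceAs (Decidable (_ ∧ _))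

/-- The rook number `r_k(B)`: the number of nonattacking placements of `k` rooks on `B`. -/
def rookNumber (B : Board) (k : ℕ) : ℕ :=
  ((B.powersetCard k).filter IsNonattacking).card

/-- The `m`-factorial polynomial `∑_{k ≥ 0} r_k(B) (x)_{m-k}`, for `m` at least the number of rows
of `B`, so that `r_k(B) = 0` for `k > m`. Here `descPochhammer ℚ j` is the falling factorial
`x (x - 1) ⋯ (x - j + 1)`. -/
noncomputable def mFactorialPolynomial (m : ℕ) (B : Board) : ℚ[X] :=
  ∑ k ∈ Finset.range (m + 1), C (rookNumber B k : ℚ) * descPochhammer ℚ (m - k)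

/-- A skew shape `λ/μ`, where `λ` is a partition with `rows` parts and `μ ⊆ λ` is a partition
(padded with zeros to `rows` parts). The parts are indexed by `0, …, rows - 1`, largest first. -/
structure SkewShape where
  rows : ℕ
  outer : Fin rows → ℕ
  inner : Fin rows → ℕ
  outer_antitone : Antitone outer
  inner_antitone : Antitone inner
  outer_pos : ∀ i, 0 < outer i
  inner_le_outer : ∀ i, inner i ≤ outer i

namespace SkewShape

/-- The skew Ferrers board of shape `λ/μ`. The first (largest) parts belong to the top row, so the
part with index `i` (from 0) belongs to the row with number `rows - i` from the bottom. -/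
def board (S : SkewShape) : Board :=
  Finset.univ.biUnion fun i : Fin S.rows =>
    (Finset.Ioc (S.inner i) (S.outer i)).image fun j => (S.rows - (i : ℕ), j)

/-- The factorial polynomial `R(x, B)` of the skew Ferrers board `B` of shape `S`: the
`m`-factorial polynomial with `m` the number of rows. An empty row of a skew shape, which is
possible when a part of `μ` equals the corresponding part of `λ`, counts as a row. -/
noncomputable def factorialPolynomial (S : SkewShape) : ℚ[X] :=
  mFactorialPolynomial S.rows S.board

end SkewShape

/-- The shape `(2n-3+t, 2n-4+t, …, n-1+t)/(n-1, n-2, …, 1)` of the `t`-Linial board `L_{t,n}`,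
which has `n - 1` rows. -/
def linialShape (t n : ℕ) : SkewShape where
  rows := n - 1
  outer i := 2 * n - 3 + t - (i : ℕ)
  inner i := n - 1 - (i : ℕ)
  outer_antitone := by
    intro i j h
    have h' : (i : ℕ) ≤ (j : ℕ) := h
    dsimp only
    omega
  inner_antitone := by
    intro i j h
    have h' : (i : ℕ) ≤ (j : ℕ) := h
    dsimp only
    omega
  outer_pos i := by
    have := i.isLt
    omega
  inner_le_outer i := by
    have := i.isLt
    omega

/-!
Write `m = n - 1` and let `ρ m u` be the value of the factorial polynomial at a natural number `u`.
By `eval_mFactorialPolynomial` it counts the ways to place `m` nonattacking rooks on the board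
enlarged by `u` full columns.

The cut after column `m` splits the board into two Ferrers boards with disjoint columns: counted from
the top, row `i` (from 0) has `i` squares to the left of the cut and `m - 1 - i` squares to the right.
Distribute the extra columns, `s` to the right part and `t` to the left part, where `s + t = u`. Once
it is known which rows place their rook in which part, the placements on either part can be counted
greedily. Thus `ρ m u` is a sum, over all words `w` of length `m` in two letters, of a product
`typeWeight s t w` of linear factors (`eval_linial_eq_sum_typeWeight`).

The decisive point is that this sum depends only on `s + t`, since `ρ m u` does. Removing the first
letter of the words at `(s, t) = (1, u - 1)` and the last letter at `(s, t) = (0, u)` expresses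
`ρ (m + 1) u` in two ways, one with a factor that counts one letter in the remaining word, the other
with a factor that counts the other letter. In the sum the two counts add up to `m`, which leaves
`2 ρ (m + 1) u = (u - 1) ρ m u + (u + m + 1) ρ m (u + 1)` for `u ≥ 1` (`two_mul_eval_linial_succ`).
By Pascal's rule the right-hand side of the theorem satisfies the same recurrence
(`binomial_power_sum_succ`), so the two polynomials agree at all positive integers.
-/

/-! ### Injective choices from a family of finite sets -/

open Classical in
/-- Systems of distinct representatives: the injective choices `f i ∈ S i` for the indices `i ∈ R`.
They are encoded as functions on all of `ι` that take the default value outside `R`. -/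
noncomputable def injectiveChoices {ι γ : Type*} [Fintype ι] [Inhabited γ]
    (R : Finset ι) (S : ι → Finset γ) : Finset (ι → γ) :=
  (Fintype.piFinset fun i => if i ∈ R then S i else {default}).filter fun f => Set.InjOn f R

section InjectiveChoices

variable {ι γ : Type*} [Fintype ι] [Inhabited γ]

theorem mem_injectiveChoices {R : Finset ι} {S : ι → Finset γ} {f : ι → γ} :
    f ∈ injectiveChoices R S ↔
      (∀ i ∈ R, f i ∈ S i) ∧ (∀ i ∉ R, f i = default) ∧ Set.InjOn f R := by
  classical
  simp only [injectiveChoices, Finset.mem_filter, Fintype.mem_piFinset]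
  constructor
  · rintro ⟨h, hinj⟩
    refine ⟨fun i hi => ?_, fun i hi => ?_, hinj⟩
    · simpa [hi] using h i
    · simpa [hi] using h i
  · rintro ⟨h1, h2, hinj⟩
    refine ⟨fun i => ?_, hinj⟩
    by_cases hi : i ∈ R
    · simpa [hi] using h1 i hi
    · simpa [hi] using h2 i hi

theorem mem_injectiveChoices_univ {S : ι → Finset γ} {f : ι → γ} :
    f ∈ injectiveChoices Finset.univ S ↔ (∀ i, f i ∈ S i) ∧ Function.Injective f := by
  simp [mem_injectiveChoices]

theorem card_injectiveChoices_empty (S : ι → Finset γ) : (injectiveChoices ∅ S).card = 1 := by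
  rw [Finset.card_eq_one]
  refine ⟨fun _ => default, ?_⟩
  ext f
  simp [mem_injectiveChoices, funext_iff]

/-- The greedy step: a new index `a` has `#(S a) - #D` free values, whatever the earlier choices
were, if these lie in `S a` for the indices in `D` and outside `S a` for all others. -/
theorem card_injectiveChoices_insert [DecidableEq ι] {R D : Finset ι} {S : ι → Finset γ} {a : ι}
    (ha : a ∉ R) (hDR : D ⊆ R) (hin : ∀ j ∈ D, S j ⊆ S a)
    (hout : ∀ j ∈ R, j ∉ D → Disjoint (S j) (S a)) :
    (injectiveChoices (insert a R) S).card =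
      (injectiveChoices R S).card * ((S a).card - D.card) := by
  classical
  have hne : ∀ i ∈ R, i ≠ a := fun i hi h => ha (h ▸ hi)
  have hmaps : ∀ f ∈ injectiveChoices (insert a R) S,
      Function.update f a default ∈ injectiveChoices R S := by
    intro f hf
    rw [mem_injectiveChoices] at hf ⊢
    obtain ⟨h1, h2, h3⟩ := hf
    refine ⟨fun i hi => ?_, fun i hi => ?_, fun i hi j hj hij => ?_⟩
    · rw [Function.update_of_ne (hne i hi)]
      exact h1 i (Finset.mem_insert_of_mem hi)
    · by_cases hia : i = a
      · subst hia; simp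
      · rw [Function.update_of_ne hia]
        exact h2 i (by simp [hia, hi])
    · rw [Function.update_of_ne (hne i hi), Function.update_of_ne (hne j hj)] at hij
      exact h3 (by simp [Finset.mem_coe.1 hi]) (by simp [Finset.mem_coe.1 hj]) hij
  rw [Finset.card_eq_sum_card_fiberwise (f := fun f => Function.update f a default)
    (t := injectiveChoices R S) (by exact hmaps)]
  refine Finset.sum_const_nat fun g hg => ?_
  obtain ⟨g1, g2, g3⟩ := mem_injectiveChoices.1 hg
  have hfib : ((injectiveChoices (insert a R) S).filter
      fun f => Function.update f a default = g) =
      (S a \ R.image g).image (Function.update g a) := by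
    ext f
    simp only [Finset.mem_filter, Finset.mem_image, Finset.mem_sdiff]
    constructor
    · rintro ⟨hf, rfl⟩
      obtain ⟨h1, h2, h3⟩ := mem_injectiveChoices.1 hf
      refine ⟨f a, ⟨h1 a (by simp), ?_⟩, by simp⟩
      rintro ⟨i, hi, hia⟩
      rw [Function.update_of_ne (hne i hi)] at hia
      exact hne i hi (h3 (by simp [hi]) (by simp) hia)
    · rintro ⟨c, ⟨hc, hcR⟩, rfl⟩
      refine ⟨mem_injectiveChoices.2 ⟨fun i hi => ?_, fun i hi => ?_, ?_⟩, ?_⟩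
      · rcases Finset.mem_insert.1 hi with rfl | hi
        · simpa using hc
        · rw [Function.update_of_ne (hne i hi)]
          exact g1 i hi
      · simp only [Finset.mem_insert, not_or] at hi
        rw [Function.update_of_ne hi.1]
        exact g2 i hi.2
      · rw [Finset.coe_insert, Set.injOn_insert (by simpa using ha)]
        refine ⟨fun i hi j hj hij => ?_, ?_⟩
        · rw [Function.update_of_ne (hne i hi), Function.update_of_ne (hne j hj)] at hij
          exact g3 hi hj hij
        · rintro ⟨i, hi, hia⟩
          rw [Function.update_of_ne (hne i hi), Function.update_self] at hia
          exact hcR ⟨i, hi, hia⟩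
      · rw [Function.update_idem, ← g2 a ha, Function.update_eq_self]
  have hused : R.image g ∩ S a = D.image g := by
    ext c
    simp only [Finset.mem_inter, Finset.mem_image]
    constructor
    · rintro ⟨⟨i, hi, rfl⟩, hc⟩
      refine ⟨i, ?_, rfl⟩
      by_contra hiD
      exact Finset.disjoint_left.1 (hout i hi hiD) (g1 i hi) hc
    · rintro ⟨i, hi, rfl⟩
      exact ⟨⟨i, hDR hi, rfl⟩, hin i hi (g1 i (hDR hi))⟩
  rw [hfib, Finset.card_image_of_injective _ (Function.update_injective g a), Finset.card_sdiff,
    hused, Finset.card_image_of_injOn (g3.mono (by exact_mod_cast hDR))]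

end InjectiveChoices

/-! ### The factorial polynomial as a count of full placements -/

/-- A nonattacking placement occupies as many rows as it has rooks. -/
theorem IsNonattacking.card_rows {m : ℕ} {r : Fin m → ℕ} (hr : Function.Injective r)
    {S : Fin m → Finset ℕ} {P : Finset (ℕ × ℕ)} (hP : IsNonattacking P)
    (hPB : P ⊆ Finset.univ.biUnion fun i => (S i).image fun j => (r i, j)) :
    (Finset.univ.filter fun i => ∃ p ∈ P, p.1 = r i).card = P.card := by
  rw [← Finset.card_image_of_injective _ hr,
    ← Finset.card_image_of_injOn (s := P) (f := Prod.fst) (fun p hp q hq h => hP.1 p hp q hq h)]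
  congr 1
  ext c
  simp only [Finset.mem_image, Finset.mem_filter, Finset.mem_univ, true_and]
  constructor
  · rintro ⟨i, ⟨p, hp, hpi⟩, rfl⟩
    exact ⟨p, hp, hpi⟩
  · rintro ⟨p, hp, rfl⟩
    have := hPB hp
    simp only [Finset.mem_biUnion, Finset.mem_univ, true_and, Finset.mem_image] at this
    obtain ⟨i, j, -, rfl⟩ := this
    exact ⟨i, ⟨_, hp, rfl⟩, rfl⟩

/-- A nonattacking placement `P` extends in `(#E)_{m - #P}` ways to a choice of distinct columns for
all `m` rows, if the rows without a rook in `P` choose from the set `E` of extra columns. -/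
theorem card_injectiveChoices_extending {m : ℕ} {r : Fin m → ℕ} (hr : Function.Injective r)
    {S : Fin m → Finset ℕ} {E : Finset ℕ} (hE : ∀ i, Disjoint (S i) E) {P : Finset (ℕ × ℕ)}
    (hP : IsNonattacking P)
    (hPB : P ⊆ Finset.univ.biUnion fun i => (S i).image fun j => (r i, j)) :
    (injectiveChoices Finset.univ fun i : Fin m =>
      if ∃ p ∈ P, p.1 = r i then (S i).filter (fun j => (r i, j) ∈ P) else E).card =
      E.card.descFactorial (m - P.card) := by
  classical
  set T : Fin m → Finset ℕ := fun i =>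
    if ∃ p ∈ P, p.1 = r i then (S i).filter (fun j => (r i, j) ∈ P) else E with hT
  set D : Finset (Fin m) := Finset.univ.filter fun i => ∃ p ∈ P, p.1 = r i with hD
  have hmemD : ∀ i, i ∈ D ↔ ∃ p ∈ P, p.1 = r i := fun i => by simp [hD]
  have hTD : ∀ i ∈ D, T i = (S i).filter (fun j => (r i, j) ∈ P) := fun i hi =>
    if_pos ((hmemD i).1 hi)
  have hTE : ∀ i ∉ D, T i = E := fun i hi => if_neg (mt (hmemD i).2 hi)
  have hone : ∀ i ∈ D, (T i).card = 1 := by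
    intro i hi
    obtain ⟨⟨a, b⟩, hp, hpi⟩ := (hmemD i).1 hi
    have hmem := hPB hp
    simp only [Finset.mem_biUnion, Finset.mem_univ, true_and, Finset.mem_image,
      Prod.mk.injEq] at hmem
    obtain ⟨i', j, hj, rfl, rfl⟩ := hmem
    obtain rfl : i' = i := hr hpi
    rw [hTD i' hi, Finset.card_eq_one]
    refine ⟨j, ?_⟩
    ext c
    simp only [Finset.mem_filter, Finset.mem_singleton]
    constructor
    · rintro ⟨-, hc⟩
      exact congrArg Prod.snd (hP.1 _ hc _ hp rfl)
    · rintro rfl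
      exact ⟨hj, hp⟩
  have hforced : ∀ R : Finset (Fin m), R ⊆ D → (injectiveChoices R T).card = 1 := by
    intro R
    induction R using Finset.induction_on with
    | empty => exact fun _ => card_injectiveChoices_empty T
    | insert a R ha ih =>
      intro hRD
      rw [Finset.insert_subset_iff] at hRD
      rw [card_injectiveChoices_insert ha (Finset.empty_subset R) (by simp), ih hRD.2,
        hone a hRD.1]
      · rfl
      · intro j hj _
        rw [hTD j (hRD.2 hj), hTD a hRD.1, Finset.disjoint_left]
        intro c hc hc'
        have := hP.2 _ (Finset.mem_filter.1 hc).2 _ (Finset.mem_filter.1 hc').2 rfl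
        exact ha (hr (congrArg Prod.fst this) ▸ hj)
  have hfree : ∀ R : Finset (Fin m), R ⊆ Dᶜ →
      (injectiveChoices (D ∪ R) T).card = E.card.descFactorial R.card := by
    intro R
    induction R using Finset.induction_on with
    | empty => intro _; simpa using hforced D subset_rfl
    | insert a R ha ih =>
      intro hRD
      rw [Finset.insert_subset_iff] at hRD
      have haD : a ∉ D := by simpa using hRD.1
      have hR : ∀ j ∈ R, j ∉ D := fun j hj => by simpa using hRD.2 hj
      rw [Finset.union_insert, card_injectiveChoices_insert (D := R) (by simp [ha, haD])
        Finset.subset_union_right, ih hRD.2, Finset.card_insert_of_notMem ha,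
        Nat.descFactorial_succ, hTE a haD, mul_comm]
      · intro j hj
        rw [hTE a haD, hTE j (hR j hj)]
      · intro j hj hjR
        have hjD : j ∈ D := (Finset.mem_union.1 hj).resolve_right hjR
        rw [hTD j hjD, hTE a haD]
        exact (hE j).mono_left (Finset.filter_subset _ _)
  have := hfree Dᶜ subset_rfl
  rwa [Finset.union_compl, Finset.card_compl, Fintype.card_fin, hP.card_rows hr hPB] at this

/-- The value of the factorial polynomial at `#E` counts the ways to place one rook in each of the
`m` rows, when a set `E` of full extra columns is adjoined to the board. -/
theorem eval_mFactorialPolynomial {m : ℕ} {r : Fin m → ℕ} (hr : Function.Injective r)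
    {S : Fin m → Finset ℕ} {E : Finset ℕ} (hE : ∀ i, Disjoint (S i) E) :
    (mFactorialPolynomial m
      (Finset.univ.biUnion fun i => (S i).image fun j => (r i, j))).eval (E.card : ℚ) =
      ((injectiveChoices Finset.univ fun i => S i ∪ E).card : ℚ) := by
  classical
  set B : Board := Finset.univ.biUnion fun i => (S i).image fun j => (r i, j) with hB
  have hmemB : ∀ i j, (r i, j) ∈ B ↔ j ∈ S i := by
    intro i j
    simp only [hB, Finset.mem_biUnion, Finset.mem_univ, true_and, Finset.mem_image,
      Prod.mk.injEq]
    constructor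
    · rintro ⟨i', j', hj, h, rfl⟩
      rwa [← hr h]
    · exact fun h => ⟨i, j, h, rfl, rfl⟩
  -- the part on `B` of a placement with one rook in every row
  let trace : (Fin m → ℕ) → Finset (ℕ × ℕ) := fun f =>
    (Finset.univ.filter fun i => f i ∉ E).image fun i => (r i, f i)
  have hmem_trace : ∀ f i j, (r i, j) ∈ trace f ↔ f i = j ∧ j ∉ E := by
    intro f i j
    simp only [trace, Finset.mem_image, Finset.mem_filter, Finset.mem_univ, true_and,
      Prod.mk.injEq]
    constructor
    · rintro ⟨i', h, hi, rfl⟩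
      rw [← hr hi]
      exact ⟨rfl, h⟩
    · rintro ⟨rfl, h⟩
      exact ⟨i, h, rfl, rfl⟩
  have hmaps : ∀ f ∈ injectiveChoices Finset.univ (fun i => S i ∪ E),
      trace f ∈ B.powerset.filter IsNonattacking := by
    intro f hf
    obtain ⟨h1, h2⟩ := mem_injectiveChoices_univ.1 hf
    rw [Finset.mem_filter, Finset.mem_powerset]
    refine ⟨?_, ?_, ?_⟩
    · intro p hp
      obtain ⟨i, hi, rfl⟩ := Finset.mem_image.1 hp
      rw [hmemB]
      exact (Finset.mem_union.1 (h1 i)).resolve_right (by simpa using hi)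
    · intro p hp q hq h
      obtain ⟨i, hi, rfl⟩ := Finset.mem_image.1 hp
      obtain ⟨j, hj, rfl⟩ := Finset.mem_image.1 hq
      rw [hr h]
    · intro p hp q hq h
      obtain ⟨i, hi, rfl⟩ := Finset.mem_image.1 hp
      obtain ⟨j, hj, rfl⟩ := Finset.mem_image.1 hq
      rw [h2 h]
  have hfiber : ∀ P ∈ B.powerset.filter IsNonattacking,
      ((injectiveChoices Finset.univ fun i => S i ∪ E).filter fun f => trace f = P).card =
        E.card.descFactorial (m - P.card) := by
    intro P hP
    rw [Finset.mem_filter, Finset.mem_powerset] at hP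
    obtain ⟨hPB, hP⟩ := hP
    rw [← card_injectiveChoices_extending hr hE hP hPB]
    congr 1
    ext f
    rw [Finset.mem_filter, mem_injectiveChoices_univ, mem_injectiveChoices_univ]
    constructor
    · rintro ⟨⟨h1, h2⟩, rfl⟩
      refine ⟨fun i => ?_, h2⟩
      by_cases hi : f i ∈ E
      · have hno : ¬ ∃ p ∈ trace f, p.1 = r i := by
          rintro ⟨⟨a, b⟩, hp, rfl : a = r i⟩
          rw [hmem_trace] at hp
          exact hp.2 (hp.1 ▸ hi)
        rwa [if_neg hno]
      · have hp : (r i, f i) ∈ trace f := (hmem_trace f i _).2 ⟨rfl, hi⟩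
        rw [if_pos ⟨_, hp, rfl⟩, Finset.mem_filter]
        exact ⟨(Finset.mem_union.1 (h1 i)).resolve_right hi, hp⟩
    · rintro ⟨h1, h2⟩
      have hrow : ∀ i, (∃ p ∈ P, p.1 = r i) → f i ∈ S i ∧ (r i, f i) ∈ P := by
        intro i hi
        have := h1 i
        rwa [if_pos hi, Finset.mem_filter] at this
      have hrow' : ∀ i, (¬ ∃ p ∈ P, p.1 = r i) → f i ∈ E := by
        intro i hi
        have := h1 i
        rwa [if_neg hi] at this
      refine ⟨⟨fun i => ?_, h2⟩, ?_⟩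
      · by_cases hi : ∃ p ∈ P, p.1 = r i
        · exact Finset.mem_union_left _ (hrow i hi).1
        · exact Finset.mem_union_right _ (hrow' i hi)
      · ext p
        constructor
        · intro hp
          obtain ⟨i, hi, rfl⟩ := Finset.mem_image.1 hp
          by_contra hcon
          by_cases h : ∃ p ∈ P, p.1 = r i
          · exact hcon (hrow i h).2
          · exact (Finset.mem_filter.1 hi).2 (hrow' i h)
        · intro hp
          obtain ⟨i, -, hi⟩ := Finset.mem_biUnion.1 (hPB hp)
          obtain ⟨j, hj, rfl⟩ := Finset.mem_image.1 hi
          have h := hrow i ⟨_, hp, rfl⟩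
          have hfj : f i = j := congrArg Prod.snd (hP.1 _ h.2 _ hp rfl)
          rw [hmem_trace]
          exact ⟨hfj, Finset.disjoint_left.1 (hE i) hj⟩
  have hcard : ∀ P ∈ B.powerset.filter IsNonattacking, P.card ∈ Finset.range (m + 1) := by
    intro P hP
    rw [Finset.mem_filter, Finset.mem_powerset] at hP
    rw [← hP.2.card_rows hr hP.1, Finset.mem_range, Nat.lt_succ_iff]
    simpa using Finset.card_le_univ (Finset.univ.filter fun i => ∃ p ∈ P, p.1 = r i)
  rw [Finset.card_eq_sum_card_fiberwise (s := injectiveChoices Finset.univ fun i => S i ∪ E)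
    (f := trace) (t := B.powerset.filter IsNonattacking) (by exact hmaps), Finset.sum_congr rfl hfiber,
    ← Finset.sum_fiberwise_of_maps_to hcard, mFactorialPolynomial, Polynomial.eval_finsetSum,
    Nat.cast_sum]
  refine Finset.sum_congr rfl fun k _ => ?_
  rw [Polynomial.eval_mul, Polynomial.eval_C, descPochhammer_eval_eq_descFactorial, rookNumber]
  have hk : (B.powersetCard k).filter IsNonattacking =
      (B.powerset.filter IsNonattacking).filter fun P => P.card = k := by
    ext P
    simp only [Finset.mem_filter, Finset.mem_powersetCard, Finset.mem_powerset]
    tauto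
  rw [hk, ← Nat.cast_mul]
  refine congrArg _ (Finset.sum_const_nat fun P hP => ?_).symm
  rw [(Finset.mem_filter.1 hP).2]

/-! ### Row types and their weights -/

/-- The weight of the row types `w`, where `w i = true` means that row `i` takes its column on the
antitone side of the board and `w i = false` that it takes it on the monotone side. There are `s`
and `t` full columns on these sides, apart from which row `i` has `m - 1 - i` squares on the antitone
side and `i` on the monotone one; the factor of row `i` is the number of columns left to it after
the shorter rows of the same type have been served. -/
def typeWeight {m : ℕ} (s t : ℕ) (w : Fin m → Bool) : ℕ :=
  ∏ i, if w i then s + ∑ j, (if i < j ∧ w j = false then 1 else 0)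
    else t + ∑ j, (if j < i ∧ w j = true then 1 else 0)

theorem typeWeight_cons_true {m : ℕ} (s t : ℕ) (w : Fin m → Bool) :
    typeWeight s t (Fin.cons true w : Fin (m + 1) → Bool) =
      (s + ∑ j, if w j = false then 1 else 0) * typeWeight s (t + 1) w := by
  simp [-Finset.sum_boole, typeWeight, Fin.prod_univ_succ, Fin.sum_univ_succ, add_assoc, Fin.succ_pos]

theorem typeWeight_cons_false {m : ℕ} (s t : ℕ) (w : Fin m → Bool) :
    typeWeight s t (Fin.cons false w : Fin (m + 1) → Bool) = t * typeWeight s t w := by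
  simp [-Finset.sum_boole, typeWeight, Fin.prod_univ_succ, Fin.sum_univ_succ]

theorem typeWeight_snoc_true {m : ℕ} (s t : ℕ) (w : Fin m → Bool) :
    typeWeight s t (Fin.snoc w true : Fin (m + 1) → Bool) = s * typeWeight s t w := by
  have h : ∀ i : Fin m, ¬ Fin.last m < i.castSucc := fun i => not_lt.2 (Fin.le_last _)
  simp [-Finset.sum_boole, typeWeight, Fin.prod_univ_castSucc, Fin.sum_univ_castSucc, h, mul_comm]

theorem typeWeight_snoc_false {m : ℕ} (s t : ℕ) (w : Fin m → Bool) :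
    typeWeight s t (Fin.snoc w false : Fin (m + 1) → Bool) =
      (t + ∑ j, if w j = true then 1 else 0) * typeWeight (s + 1) t w := by
  simp [-Finset.sum_boole, typeWeight, Fin.prod_univ_castSucc, Fin.sum_univ_castSucc,
    Fin.castSucc_lt_last, mul_comm, add_assoc, add_comm]

theorem sum_typeWeight_succ_cons (m s t : ℕ) :
    ∑ w : Fin (m + 1) → Bool, typeWeight s t w =
      ∑ w : Fin m → Bool, (s + ∑ j, if w j = false then 1 else 0) * typeWeight s (t + 1) w +
        t * ∑ w : Fin m → Bool, typeWeight s t w := by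
  rw [← (Fin.consEquiv fun _ => Bool).sum_comp, Fintype.sum_prod_type, Fintype.sum_bool,
    Finset.mul_sum]
  simp only [Fin.consEquiv, Equiv.coe_fn_mk]
  congr 1
  · exact Finset.sum_congr rfl fun w _ => typeWeight_cons_true s t w
  · exact Finset.sum_congr rfl fun w _ => typeWeight_cons_false s t w

theorem sum_typeWeight_succ_snoc (m s t : ℕ) :
    ∑ w : Fin (m + 1) → Bool, typeWeight s t w =
      s * ∑ w : Fin m → Bool, typeWeight s t w +
        ∑ w : Fin m → Bool, (t + ∑ j, if w j = true then 1 else 0) * typeWeight (s + 1) t w := by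
  rw [← (Fin.snocEquiv fun _ => Bool).sum_comp, Fintype.sum_prod_type, Fintype.sum_bool,
    Finset.mul_sum]
  simp only [Fin.snocEquiv, Equiv.coe_fn_mk]
  congr 1
  · exact Finset.sum_congr rfl fun w _ => typeWeight_snoc_true s t w
  · exact Finset.sum_congr rfl fun w _ => typeWeight_snoc_false s t w

/-! ### Boards split into two Ferrers boards -/

/-- For fixed row types each side is a Ferrers board, so its columns can be chosen greedily, starting
with its shortest row. -/
theorem card_injectiveChoices_types {m s t : ℕ} {U L : Fin m → Finset ℕ} (hU : Antitone U)
    (hL : Monotone L) (hUL : ∀ i j, Disjoint (U i) (L j))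
    (hUcard : ∀ i : Fin m, (U i).card = s + (m - 1 - i)) (hLcard : ∀ i, (L i).card = t + i)
    (w : Fin m → Bool) :
    (injectiveChoices Finset.univ fun i => if w i then U i else L i).card = typeWeight s t w := by
  classical
  set T : Fin m → Finset ℕ := fun i => if w i then U i else L i with hT
  have hTU : ∀ i, w i = true → T i = U i := fun i hi => by simp [hT, hi]
  have hTL : ∀ i, w i = false → T i = L i := fun i hi => by simp [hT, hi]
  set W : Finset (Fin m) := Finset.univ.filter fun i => w i = true with hW
  have hupper : ∀ R : Finset (Fin m), R ⊆ W →
      (injectiveChoices R T).card =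
        ∏ i ∈ R, ((U i).card - (R.filter fun j => i < j).card) := by
    intro R
    induction R using Finset.induction_on_min with
    | empty => intro _; simpa using card_injectiveChoices_empty T
    | insert a R ha ih =>
      intro hRW
      rw [Finset.insert_subset_iff] at hRW
      have haR : a ∉ R := fun h => lt_irrefl _ (ha a h)
      have hw : ∀ j ∈ R, w j = true := fun j hj => by simpa [hW] using hRW.2 hj
      have hwa : w a = true := by simpa [hW] using hRW.1
      rw [card_injectiveChoices_insert (D := R) haR subset_rfl, ih hRW.2,
        Finset.prod_insert haR, hTU a hwa, mul_comm]
      · congr 1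
        · rw [Finset.filter_insert, if_neg (lt_irrefl a), Finset.filter_true_of_mem ha]
        · refine Finset.prod_congr rfl fun i hi => ?_
          rw [Finset.filter_insert, if_neg (ha i hi).not_gt]
      · intro j hj
        rw [hTU j (hw j hj), hTU a hwa]
        exact hU (ha j hj).le
      · exact fun j hj hj' => absurd hj hj'
  have hlower : ∀ R : Finset (Fin m), R ⊆ Wᶜ →
      (injectiveChoices (W ∪ R) T).card = (injectiveChoices W T).card *
        ∏ i ∈ R, ((L i).card - (R.filter fun j => j < i).card) := by
    intro R
    induction R using Finset.induction_on_max with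
    | empty => intro _; simp
    | insert a R ha ih =>
      intro hRW
      rw [Finset.insert_subset_iff] at hRW
      have haR : a ∉ R := fun h => lt_irrefl _ (ha a h)
      have hw : ∀ j ∈ R, w j = false := fun j hj => by simpa [hW] using hRW.2 hj
      have hwa : w a = false := by simpa [hW] using hRW.1
      rw [Finset.union_insert, card_injectiveChoices_insert (D := R) (by simp [haR, hW, hwa])
        Finset.subset_union_right, ih hRW.2, Finset.prod_insert haR, hTL a hwa, mul_assoc]
      · rw [mul_comm (∏ i ∈ R, _)]
        congr 2
        · rw [Finset.filter_insert, if_neg (lt_irrefl a), Finset.filter_true_of_mem ha]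
        · refine Finset.prod_congr rfl fun i hi => ?_
          rw [Finset.filter_insert, if_neg (ha i hi).not_gt]
      · intro j hj
        rw [hTL j (hw j hj), hTL a hwa]
        exact hL (ha j hj).le
      · intro j hj hjR
        have hjW : w j = true := by
          simpa [hW] using (Finset.mem_union.1 hj).resolve_right hjR
        rw [hTU j hjW, hTL a hwa]
        exact hUL j a
  have hall := hlower Wᶜ subset_rfl
  rw [Finset.union_compl, hupper W subset_rfl] at hall
  rw [hall, typeWeight, ← Finset.prod_mul_prod_compl W]
  congr 1
  · refine Finset.prod_congr rfl fun i hi => ?_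
    have hwi : w i = true := by simpa [hW] using hi
    -- of the `m - 1 - i` later rows, those of the same type use up a column each
    have hsplit : (W.filter fun j => i < j).card +
        (Finset.univ.filter fun j => i < j ∧ w j = false).card = m - 1 - i := by
      rw [← Fin.card_Ioi, ← Finset.card_filter_add_card_filter_not (s := Finset.Ioi i)
        (fun j => w j = true)]
      congr 2 <;> ext j <;> simp [hW, and_comm]
    rw [if_pos hwi, hUcard, ← Finset.card_filter]
    omega
  · refine Finset.prod_congr rfl fun i hi => ?_
    have hwi : w i = false := by simpa [hW] using hi
    have hsplit : (Wᶜ.filter fun j => j < i).card +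
        (Finset.univ.filter fun j => j < i ∧ w j = true).card = i := by
      conv_rhs => rw [← Fin.card_Iio, ← Finset.card_filter_add_card_filter_not
        (s := Finset.Iio i) (fun j => w j = false)]
      congr 2 <;> ext j <;> simp [hW, and_comm]
    rw [if_neg (by simp [hwi]), hLcard, ← Finset.card_filter]
    omega

theorem card_injectiveChoices_union {m s t : ℕ} {U L : Fin m → Finset ℕ} (hU : Antitone U)
    (hL : Monotone L) (hUL : ∀ i j, Disjoint (U i) (L j))
    (hUcard : ∀ i : Fin m, (U i).card = s + (m - 1 - i)) (hLcard : ∀ i, (L i).card = t + i) :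
    (injectiveChoices Finset.univ fun i => U i ∪ L i).card =
      ∑ w : Fin m → Bool, typeWeight s t w := by
  classical
  rw [Finset.card_eq_sum_card_fiberwise
    (f := fun f (i : Fin m) => decide (f i ∈ U i)) (t := Finset.univ) (by simp)]
  refine Finset.sum_congr rfl fun w _ => ?_
  rw [← card_injectiveChoices_types hU hL hUL hUcard hLcard w]
  congr 1
  ext f
  rw [Finset.mem_filter, mem_injectiveChoices_univ, mem_injectiveChoices_univ, funext_iff]
  constructor
  · rintro ⟨⟨h1, h2⟩, hw⟩
    refine ⟨fun i => ?_, h2⟩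
    have h := h1 i
    rw [Finset.mem_union] at h
    by_cases hi : f i ∈ U i
    · simp [← hw i, hi]
    · simpa [← hw i, hi] using h
  · rintro ⟨h1, h2⟩
    refine ⟨⟨fun i => ?_, h2⟩, fun i => ?_⟩
    · have h := h1 i
      rw [Finset.mem_union]
      split_ifs at h
      · exact Or.inl h
      · exact Or.inr h
    · have h := h1 i
      cases hi : w i with
      | true => simpa [hi] using h
      | false =>
        have h' : f i ∈ L i := by simpa [hi] using h
        simpa using Finset.disjoint_right.1 (hUL i i) h'

/-- The factorial polynomial at `s + t`, through any splitting of the extra columns. The band of the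
board is cut at column `m`: the columns to its right form the antitone side and those to its left the
monotone one, and these sides receive `s` and `t` of the extra columns, respectively. -/
theorem eval_linial_eq_sum_typeWeight (m s t : ℕ) :
    (linialShape 0 (m + 1)).factorialPolynomial.eval ((s + t : ℕ) : ℚ) =
      ((∑ w : Fin m → Bool, typeWeight s t w : ℕ) : ℚ) := by
  have hr : Function.Injective fun i : Fin m => m - (i : ℕ) := by
    intro i j h
    ext
    have := i.isLt
    have := j.isLt
    dsimp only at h
    omega
  have hE : ∀ i : Fin m, Disjoint (Finset.Ioc (m - (i : ℕ)) (2 * (m + 1) - 3 + 0 - (i : ℕ)))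
      (Finset.Ico (2 * m) (2 * m + (s + t))) := by
    intro i
    rw [Finset.disjoint_left]
    intro c
    have := i.isLt
    simp only [Finset.mem_Ioc, Finset.mem_Ico]
    omega
  have h := eval_mFactorialPolynomial hr hE
  rw [Nat.card_Ico, Nat.add_sub_cancel_left] at h
  refine Eq.trans h ?_
  rw [← card_injectiveChoices_union
    (U := fun i : Fin m => Finset.Ioc m (2 * m - 1 - i) ∪ Finset.Ico (2 * m) (2 * m + s))
    (L := fun i : Fin m => Finset.Ioc (m - i) m ∪ Finset.Ico (2 * m + s) (2 * m + (s + t)))]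
  · congr 3
    ext i c
    have := i.isLt
    simp only [Finset.mem_union, Finset.mem_Ioc, Finset.mem_Ico]
    omega
  · intro i j hij c
    have hij' : (i : ℕ) ≤ j := hij
    simp only [Finset.mem_union, Finset.mem_Ioc, Finset.mem_Ico]
    omega
  · intro i j hij c
    have hij' : (i : ℕ) ≤ j := hij
    simp only [Finset.mem_union, Finset.mem_Ioc, Finset.mem_Ico]
    omega
  · intro i j
    rw [Finset.disjoint_left]
    intro c
    have := i.isLt
    have := j.isLt
    simp only [Finset.mem_union, Finset.mem_Ioc, Finset.mem_Ico]
    omega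
  · intro i
    have := i.isLt
    rw [Finset.card_union_of_disjoint, Nat.card_Ioc, Nat.card_Ico]
    · omega
    · rw [Finset.disjoint_left]
      intro c
      simp only [Finset.mem_Ioc, Finset.mem_Ico]
      omega
  · intro i
    have := i.isLt
    rw [Finset.card_union_of_disjoint, Nat.card_Ioc, Nat.card_Ico]
    · omega
    · rw [Finset.disjoint_left]
      intro c
      simp only [Finset.mem_Ioc, Finset.mem_Ico]
      omega

/-! ### The recurrence and the closed form -/

/-- The recurrence comes from computing the left-hand side in two ways: remove the first row after
putting one of the `u + 1` extra columns on the antitone side, and remove the last row after putting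
all of them on the monotone side. In the sum of the two results the numbers of rows of either type
add up to `m`. -/
theorem two_mul_eval_linial_succ (m u : ℕ) :
    2 * (linialShape 0 (m + 2)).factorialPolynomial.eval ((u + 1 : ℕ) : ℚ) =
      u * (linialShape 0 (m + 1)).factorialPolynomial.eval ((u + 1 : ℕ) : ℚ) +
        (u + m + 2) * (linialShape 0 (m + 1)).factorialPolynomial.eval ((u + 2 : ℕ) : ℚ) := by
  have h1 := eval_linial_eq_sum_typeWeight (m + 1) 1 u
  have h2 := eval_linial_eq_sum_typeWeight (m + 1) 0 (u + 1)
  have h3 := eval_linial_eq_sum_typeWeight m 1 u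
  have h4 := eval_linial_eq_sum_typeWeight m 1 (u + 1)
  rw [sum_typeWeight_succ_cons] at h1
  rw [sum_typeWeight_succ_snoc] at h2
  have hadd : ∑ w : Fin m → Bool, (1 + ∑ j, if w j = false then 1 else 0) * typeWeight 1 (u + 1) w +
      ∑ w : Fin m → Bool, (u + 1 + ∑ j, if w j = true then 1 else 0) * typeWeight (0 + 1) (u + 1) w =
      (u + m + 2) * ∑ w : Fin m → Bool, typeWeight 1 (u + 1) w := by
    rw [← Finset.sum_add_distrib, Finset.mul_sum]
    refine Finset.sum_congr rfl fun w _ => ?_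
    have hm : (∑ j, if w j = false then 1 else 0) + (∑ j, if w j = true then 1 else 0) = m := by
      rw [← Finset.sum_add_distrib]
      have : ∀ j, ((if w j = false then 1 else 0) + (if w j = true then 1 else 0) : ℕ) = 1 :=
        fun j => by cases w j <;> rfl
      simp [this]
    rw [zero_add, ← add_mul]
    congr 1
    omega
  rw [show 1 + u = u + 1 from add_comm 1 u] at h1 h3
  rw [zero_add] at h2
  rw [show 1 + (u + 1) = u + 2 by ring] at h4
  have hadd' := congrArg (Nat.cast (R := ℚ)) hadd
  rw [h3, h4, two_mul]
  nth_rewrite 1 [h1]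
  rw [h2]
  push_cast at hadd' ⊢
  linarith

/-- The right-hand side, cleared of its power of `2` and shifted to `x = t - 1`, obeys the recurrence
of the factorial polynomials. -/
theorem binomial_power_sum_succ (m : ℕ) (x : ℚ) :
    ∑ j ∈ Finset.range (m + 3), ((m + 2).choose j : ℚ) * (x + j) ^ (m + 1) =
      x * ∑ j ∈ Finset.range (m + 2), ((m + 1).choose j : ℚ) * (x + j) ^ m +
        (x + m + 2) * ∑ j ∈ Finset.range (m + 2), ((m + 1).choose j : ℚ) * (x + 1 + j) ^ m := by
  have htop : ∑ j ∈ Finset.range (m + 2), ((m + 1).choose j : ℚ) * (x + j) ^ m =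
      ∑ j ∈ Finset.range (m + 2), ((m + 1).choose (j + 1) : ℚ) * (x + 1 + j) ^ m + x ^ m := by
    rw [Finset.sum_range_succ', Finset.sum_range_succ _ (m + 1)]
    simp only [Nat.choose_succ_self, Nat.choose_zero_right]
    push_cast
    simp [add_assoc, add_comm (1 : ℚ)]
  rw [htop, Finset.sum_range_succ', mul_add, Finset.mul_sum, Finset.mul_sum, add_right_comm,
    ← Finset.sum_add_distrib]
  congr 1
  · refine Finset.sum_congr rfl fun j _ => ?_
    have h1 : ((m + 2).choose (j + 1) : ℚ) = (m + 1).choose j + (m + 1).choose (j + 1) := by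
      exact_mod_cast Nat.choose_succ_succ (m + 1) j
    have h2 : ((m : ℚ) + 2) * (m + 1).choose j = (m + 2).choose (j + 1) * (j + 1) := by
      exact_mod_cast Nat.add_one_mul_choose_eq (m + 1) j
    push_cast
    have h3 : (x + (j + 1)) ^ (m + 1) = (x + 1 + j) ^ m * (x + (j + 1)) := by
      rw [pow_succ]; ring
    rw [h3]
    linear_combination (x + 1 + (j : ℚ)) ^ m * (x * h1 - h2)
  · simp [pow_succ, mul_comm]

theorem eval_linial (m u : ℕ) :
    (linialShape 0 (m + 1)).factorialPolynomial.eval ((u + 1 : ℕ) : ℚ) =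
      1 / 2 ^ (m + 1) *
        ∑ j ∈ Finset.range (m + 2), ((m + 1).choose j : ℚ) * ((u : ℚ) + j) ^ m := by
  induction m generalizing u with
  | zero =>
    have h := eval_linial_eq_sum_typeWeight 0 0 (u + 1)
    rw [zero_add] at h
    rw [h]
    norm_num [typeWeight, Finset.sum_range_succ]
  | succ m ih =>
    have h := two_mul_eval_linial_succ m u
    have ih' := ih (u + 1)
    rw [ih u, show u + 2 = u + 1 + 1 from rfl, ih'] at h
    rw [binomial_power_sum_succ, pow_succ]
    push_cast at h ⊢
    rw [← mul_right_inj' (two_ne_zero (α := ℚ)), h]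
    field_simp

theorem mainTheorem3 (n : ℕ) (hn : 2 ≤ n) :
    (linialShape 0 n).factorialPolynomial =
      C ((1 : ℚ) / 2 ^ n) *
        ∑ j ∈ Finset.range (n + 1), C (n.choose j : ℚ) * (X - 1 + C (j : ℚ)) ^ (n - 1) := by
  obtain ⟨m, rfl⟩ : ∃ m, n = m + 1 := ⟨n - 1, by omega⟩
  refine Polynomial.eq_of_infinite_eval_eq _ _
    ((Set.infinite_range_of_injective (f := fun u : ℕ => ((u + 1 : ℕ) : ℚ)) ?_).mono ?_)
  · intro a b h
    simpa using h
  · rintro _ ⟨u, rfl⟩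
    rw [Set.mem_ofPred_eq, eval_linial]
    simp [Polynomial.eval_finsetSum]
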